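/- Let $n\ge 1$ and $k\ge 1$ be integers and $S=\{1,\dots,k\}$. For nonnegative numbers $\gamma_{ij}$ ($1\le i<j\le m$), exponents $p_i\in[1,\infty]$ ($1\le i\le m$, with $1/\infty=0$) and $I\subseteq\{1,\dots,m\}$ write $\sum_I \frac1{p_i}=\sum_{i\in I}\frac1{p_i}$ and $\sum_I\gamma_{ij}=\sum_{i,j\in I,\ i<j}\gamma_{ij}$. Say that $\{\gamma_{ij}\}_{1\le i<j\le m}$ and $\{p_i\}_{1\le i\le m}$ satisfy condition $(\mathrm P_m)$ if (i) $\displaystyle\sum_{i=1}^{m}\frac1{p_i}+\sum_{1\le i<j\le m}\frac{\gamma_{ij}}n=m$; (ii) $\displaystyle\sum_I\frac{\gamma_{ij}}n<|I|-1$ for every $I\subseteq\{1,\dots,m\}$ with $|I|\ge2$; (iii)(a) $\displaystyle\sum_I\frac1{p_i}+\sum_I\frac{\gamma_{ij}}n<|I|$ for every nonempty proper subset $I\subsetneq\{1,\dots,m\}$. **Theorem.** Let $\alpha_{ij}\ge0$ for $1\le i<j\le k+1$, let $1<p_i<\infty$ for $1\le i\le k$ and $p_{k+1}=\infty$, and suppose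 that $\{\alpha_{ij}\}_{1\le i<j\le k+1}$ and $\{p_i\}_{1\le i\le k+1}$ satisfy $(\mathrm P_{k+1})$. Then there are a finite set $\Delta$ and, for each $t\in\Delta$, nonnegative numbers $\{\beta_{ij}(t)\}_{1\le i<j\le k}$ such that $\{\beta_{ij}(t)\}_{i<j\in S}$ and $\{p_i\}_{i\in S}$ satisfy $(\mathrm P_k)$ for every $t\in\Delta$ and, for all measurable functions $f_1,\dots,f_k$ on $\mathbb R^n$, $$\int_{\mathbb R^{n(k+1)}}\prod_{i=1}^k|f_i(x_i)|\prod_{1\le i<j\le k+1}|x_i-x_j|^{-\alpha_{ij}}\,dx_1\cdots dx_{k+1}\le C\sum_{t\in\Delta}\int_{\mathbb R^{nk}}\prod_{i=1}^k|f_i(x_i)|\prod_{1\le i<j\le k}|x_i-x_j|^{-\beta_{ij}(t)}\,dx_1\cdots dx_k ,$$ as an inequality in $[0,\infty]$. The constant $C\in(0,\infty)$ depends only on $\alpha_{1,k+1},\dots,\alpha_{k,k+1}$ and the dimension $n$; the set $\Delta$ and the numbers $\beta_{ij}(t)$ may depend on $n$ and on all $\alpha_{ij}$ and $p_i$, but not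 on the $f_i$. -/

import Mathlib

open MeasureTheory
open scoped ENNReal NNReal

/-- `∑_{i ∈ I} 1 / p_i`, with `1 / ∞ = 0`. -/
noncomputable def recipSum {m : ℕ} (p : Fin m → ℝ≥0∞) (I : Finset (Fin m)) : ℝ :=
  ∑ i ∈ I, ((p i)⁻¹).toReal

/-- `∑_{i < j; i, j ∈ I} α_{ij}`. Only the entries with `i < j` are used. -/
def pairSum {m : ℕ} (α : Fin m → Fin m → ℝ) (I : Finset (Fin m)) : ℝ :=
  ∑ i ∈ I, ∑ j ∈ I with i < j, α i j

/-- Condition (i) for `m` points in dimension `n`. -/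
def ScalingCondition (n : ℕ) {m : ℕ} (α : Fin m → Fin m → ℝ) (p : Fin m → ℝ≥0∞) : Prop :=
  recipSum p Finset.univ + pairSum α Finset.univ / (n : ℝ) = (m : ℝ)

/-- Condition (ii) for `m` points in dimension `n`. -/
def LocalIntegrabilityCondition (n : ℕ) {m : ℕ} (α : Fin m → Fin m → ℝ) : Prop :=
  ∀ I : Finset (Fin m), 2 ≤ I.card → pairSum α I / (n : ℝ) < (I.card : ℝ) - 1

/-- The first alternative (a) of condition (iii), for every nonempty proper subset `I` of the
index set. -/
def StrictSubsetCondition (n : ℕ) {m : ℕ} (α : Fin m → Fin m → ℝ) (p : Fin m → ℝ≥0∞) : Prop :=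
  ∀ I : Finset (Fin m), I.Nonempty → I ≠ Finset.univ →
    recipSum p I + pairSum α I / (n : ℝ) < (I.card : ℝ)

/-- The correlation kernel `∏_{i < j} |x_i - x_j| ^ (-α_{ij})`, with values in `[0, ∞]`. -/
noncomputable def correlationKernel {n m : ℕ} (α : Fin m → Fin m → ℝ)
    (x : Fin m → EuclideanSpace ℝ (Fin n)) : ℝ≥0∞ :=
  ∏ i : Fin m, ∏ j : Fin m with i < j, ‖x i - x j‖ₑ ^ (-(α i j))

/-! Only the last variable `y` is integrated out. Let `a i` be its exponents and `s = ∑ a i - n`; `s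
> 0` follows from (i) and from (iii) for the first `k` points. It suffices to bound `∫ ∏ |x_i - y| ^
(-a i) dy` by a finite sum of kernels `K = ∏ |x_i - x_j| ^ (-δ i j)` of total weight `s` for which
`α + δ` satisfies the conditions for `k` points.

Split the `y`-space by the ordering `r` of the distances `|x_i - y|`, with `x_0` the nearest point.
Since `|x_i - x_j| ≤ 2 max (|x_i - y|, |x_j - y|)`, `K` is bounded below by distances to `y`. If `δ`
is heavy enough on each initial set of `r`, summation by parts bounds the integrand by a constant
times `|x_0 - y| ^ (-(n - ε s)) K ^ (1 + ε)`; it is also at most `|x_0 - y| ^ (-(n + s))`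
(`prod_enorm_rpow_le`). The minimum of the two integrates to a multiple of `K` by scaling
(`exists_lintegral_min_le`).

The choice of `δ` is combinatorial (`exists_pair_weights`). The conditions on `α + δ` are upper
bounds `δ(T) ≤ g(T)` with `g` submodular; the initial sets demand `δ(T) ≥ F(T)` with `F ≤ g`
monotone. Along a chain a greedy choice meets all demands (`exists_feasible_of_demand`). The
hypotheses are finitely many strict inequalities, which leaves room for `ε`. -/

/-! ### Total pair weight inside a set. -/

section PairSums

variable {k : ℕ}

theorem pairSum_add (v w : Fin k → Fin k → ℝ) (T : Finset (Fin k)) :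
    pairSum (fun i j => v i j + w i j) T = pairSum v T + pairSum w T := by
  simp only [pairSum, Finset.sum_add_distrib]

theorem pairSum_mul_left (c : ℝ) (w : Fin k → Fin k → ℝ) (T : Finset (Fin k)) :
    pairSum (fun i j => c * w i j) T = c * pairSum w T := by
  simp only [pairSum, Finset.mul_sum]

theorem pairSum_mono {v w : Fin k → Fin k → ℝ} {T : Finset (Fin k)}
    (h : ∀ i ∈ T, ∀ j ∈ T, i < j → v i j ≤ w i j) : pairSum v T ≤ pairSum w T := by
  refine Finset.sum_le_sum fun i hi => Finset.sum_le_sum fun j hj => ?_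
  rw [Finset.mem_filter] at hj
  exact h i hi j hj.1 hj.2

theorem pairSum_singleton (w : Fin k → Fin k → ℝ) (i : Fin k) : pairSum w {i} = 0 := by
  simp [pairSum, Finset.filter_singleton]

theorem pairSum_eq_sum_univ (w : Fin k → Fin k → ℝ) (T : Finset (Fin k)) :
    pairSum w T = ∑ i, ∑ j, if i < j ∧ i ∈ T ∧ j ∈ T then w i j else 0 := by
  simp only [pairSum, Finset.sum_filter]
  have : ∀ f : Fin k → ℝ, ∑ i ∈ T, f i = ∑ i, if i ∈ T then f i else 0 := by simp
  rw [this]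
  refine Finset.sum_congr rfl fun i _ => ?_
  split_ifs with hi
  · rw [this]
    refine Finset.sum_congr rfl fun j _ => ?_
    by_cases hj : j ∈ T <;> by_cases hij : i < j <;> simp [hi, hj, hij]
  · simp [hi]

theorem pairSum_insert (w : Fin k → Fin k → ℝ) {T : Finset (Fin k)} {v : Fin k} (hv : v ∉ T) :
    pairSum w (insert v T) = pairSum w T + ∑ u ∈ T, w (min u v) (max u v) := by
  have h1 : ∀ i ∈ T, ∑ j ∈ insert v T with i < j, w i j
      = ∑ j ∈ T with i < j, w i j + if i < v then w i v else 0 := by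
    intro i _
    simp only [Finset.sum_filter]
    rw [Finset.sum_insert hv, add_comm]
  have h2 : ∑ j ∈ insert v T with v < j, w v j = ∑ j ∈ T, if v < j then w v j else 0 := by
    simp only [Finset.sum_filter]
    rw [Finset.sum_insert hv]
    simp
  rw [pairSum, Finset.sum_insert hv, h2, Finset.sum_congr rfl h1, Finset.sum_add_distrib,
    pairSum, add_comm, add_assoc, ← Finset.sum_add_distrib]
  congr 1
  refine Finset.sum_congr rfl fun u hu => ?_
  rcases lt_trichotomy u v with h | h | h
  · simp [h, h.not_gt, h.le]
  · exact absurd (h ▸ hu) hv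
  · simp [h, h.not_gt, h.le]

/-- Pairs joining `S \ T` to `T \ S` are counted only in the union; all other pairs are counted
equally on both sides. -/
theorem pairSum_supermodular {w : Fin k → Fin k → ℝ} (hw : ∀ i j, i < j → 0 ≤ w i j)
    (S T : Finset (Fin k)) :
    pairSum w S + pairSum w T ≤ pairSum w (S ∪ T) + pairSum w (S ∩ T) := by
  simp only [pairSum_eq_sum_univ, ← Finset.sum_add_distrib]
  refine Finset.sum_le_sum fun i _ => Finset.sum_le_sum fun j _ => ?_
  by_cases hij : i < j
  · have := hw i j hij
    by_cases h1 : i ∈ S <;> by_cases h2 : i ∈ T <;> by_cases h3 : j ∈ S <;> by_cases h4 : j ∈ T <;>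
      simp [h1, h2, h3, h4, hij, this]
  · simp [hij]

/-- The weight `t` on the single pair `u < v`. -/
def singlePair (u v : Fin k) (t : ℝ) (i j : Fin k) : ℝ := if i = u ∧ j = v then t else 0

theorem pairSum_singlePair {u v : Fin k} (huv : u < v) (t : ℝ) (T : Finset (Fin k)) :
    pairSum (singlePair u v t) T = if u ∈ T ∧ v ∈ T then t else 0 := by
  rw [pairSum_eq_sum_univ, Finset.sum_eq_single u, Finset.sum_eq_single v]
  · simp [singlePair, huv]
  · intro j _ hj; simp [singlePair, hj]
  · simp
  · intro i _ hi; simp [singlePair, hi]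
  · simp

theorem pairSum_update {w : Fin k → Fin k → ℝ} {u v : Fin k} (huv : u < v) (t : ℝ)
    (T : Finset (Fin k)) :
    pairSum (fun i j => w i j + singlePair u v t i j) T
      = pairSum w T + if u ∈ T ∧ v ∈ T then t else 0 := by
  rw [pairSum_add, pairSum_singlePair huv]

end PairSums

/-! ### Greedy choice of pair weights under submodular bounds. -/

section Greedy

variable {k : ℕ}

/-- `g` is submodular on pairs of sets with a common point. -/
def IntersectingSubmodular (g : Finset (Fin k) → ℝ) : Prop :=
  ∀ S T : Finset (Fin k), (S ∩ T).Nonempty → g (S ∪ T) + g (S ∩ T) ≤ g S + g T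

/-- Nonnegative pair weights whose total weight inside any nonempty set is bounded by `g`. -/
structure Feasible (g : Finset (Fin k) → ℝ) (w : Fin k → Fin k → ℝ) : Prop where
  nonneg : ∀ i j, i < j → 0 ≤ w i j
  le : ∀ T : Finset (Fin k), T.Nonempty → pairSum w T ≤ g T

/-- Uncrossing: submodularity of `g` against supermodularity of the weight forces equality on the
union. The common point is needed because feasibility says nothing about the empty set. -/
theorem Feasible.tight_union {g : Finset (Fin k) → ℝ} (hg : IntersectingSubmodular g)
    {w : Fin k → Fin k → ℝ} (hw : Feasible g w) {S T : Finset (Fin k)} (hST : (S ∩ T).Nonempty)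
    (hS : pairSum w S = g S) (hT : pairSum w T = g T) : pairSum w (S ∪ T) = g (S ∪ T) := by
  have h1 := hg S T hST
  have h2 := pairSum_supermodular hw.nonneg S T
  have h3 := hw.le _ hST
  have h4 := hw.le (S ∪ T) (hST.mono (Finset.inter_subset_left.trans Finset.subset_union_left))
  linarith

/-- Fix `x ∈ J`. Tight sets through `x` and each other point of `J` all share `x`, so their union is
tight. -/
theorem Feasible.exists_tight_superset {g : Finset (Fin k) → ℝ} (hg : IntersectingSubmodular g)
    (hg1 : ∀ v, g {v} = 0) {w : Fin k → Fin k → ℝ} (hw : Feasible g w) {J : Finset (Fin k)}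
    {x : Fin k} (hx : x ∈ J)
    (hJ : ∀ u ∈ J, ∀ v ∈ J, u < v → ∃ T : Finset (Fin k), u ∈ T ∧ v ∈ T ∧ pairSum w T = g T) :
    ∃ T : Finset (Fin k), J ⊆ T ∧ pairSum w T = g T := by
  have hpair : ∀ v ∈ J, ∃ T : Finset (Fin k), x ∈ T ∧ v ∈ T ∧ pairSum w T = g T := by
    intro v hv
    rcases lt_trichotomy x v with h | rfl | h
    · exact hJ x hx v hv h
    · exact ⟨{x}, by simp, by simp, by rw [pairSum_singleton, hg1]⟩
    · obtain ⟨T, h1, h2, h3⟩ := hJ v hv x hx h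
      exact ⟨T, h2, h1, h3⟩
  suffices ∀ B : Finset (Fin k), B ⊆ J →
      ∃ T : Finset (Fin k), x ∈ T ∧ B ⊆ T ∧ pairSum w T = g T by
    obtain ⟨T, -, h2, h3⟩ := this J subset_rfl
    exact ⟨T, h2, h3⟩
  intro B
  induction B using Finset.induction_on with
  | empty => exact fun _ => ⟨{x}, by simp, by simp, by rw [pairSum_singleton, hg1]⟩
  | insert v B _ ih =>
    intro hB
    rw [Finset.insert_subset_iff] at hB
    obtain ⟨T, h1, h2, h3⟩ := ih hB.2
    obtain ⟨T', h1', h2', h3'⟩ := hpair v hB.1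
    refine ⟨T ∪ T', by simp [h1], ?_, hw.tight_union hg ⟨x, by simp [h1, h1']⟩ h3 h3'⟩
    rw [Finset.insert_subset_iff]
    exact ⟨by simp [h2'], h2.trans Finset.subset_union_left⟩

/-- Raise the weight of one pair until some set containing it is tight, or the total is `b`. -/
theorem Feasible.raise_pair {g : Finset (Fin k) → ℝ} {w : Fin k → Fin k → ℝ} (hw : Feasible g w)
    {b : ℝ} (hb : pairSum w Finset.univ ≤ b) {u v : Fin k} (huv : u < v) :
    ∃ t : ℝ, 0 ≤ t ∧ Feasible g (fun i j => w i j + singlePair u v t i j) ∧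
      pairSum w Finset.univ + t ≤ b ∧
      (pairSum w Finset.univ + t = b ∨ ∃ T : Finset (Fin k), u ∈ T ∧ v ∈ T ∧
        pairSum (fun i j => w i j + singlePair u v t i j) T = g T) := by
  obtain ⟨T₀, hT₀, hmin⟩ := Finset.exists_min_image
    (Finset.univ.filter fun T : Finset (Fin k) => u ∈ T ∧ v ∈ T) (fun T => g T - pairSum w T)
    ⟨Finset.univ, by simp⟩
  simp only [Finset.mem_filter, Finset.mem_univ, true_and] at hT₀ hmin
  have h0 := hw.le T₀ ⟨u, hT₀.1⟩
  set t := min (g T₀ - pairSum w T₀) (b - pairSum w Finset.univ) with ht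
  have ht0 : 0 ≤ t := le_min (by linarith) (by linarith)
  have ht1 : t ≤ g T₀ - pairSum w T₀ := min_le_left _ _
  have ht2 : t ≤ b - pairSum w Finset.univ := min_le_right _ _
  refine ⟨t, ht0, ⟨fun i j hij => ?_, fun T hT => ?_⟩, by linarith, ?_⟩
  · refine add_nonneg (hw.nonneg i j hij) ?_
    unfold singlePair
    split_ifs
    · exact ht0
    · exact le_rfl
  · rw [pairSum_update huv]
    split_ifs with h
    · linarith [hmin T h]
    · linarith [hw.le T hT]
  · rcases min_choice (g T₀ - pairSum w T₀) (b - pairSum w Finset.univ) with h | h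
    · right
      refine ⟨T₀, hT₀.1, hT₀.2, ?_⟩
      rw [pairSum_update huv, if_pos hT₀, ht, h]
      ring
    · left
      rw [ht, h]
      ring

/-- Raising the weights of pairs inside `J` reaches any total `b ≤ g T`, `T ⊇ J`. -/
theorem Feasible.exists_raise {g : Finset (Fin k) → ℝ} (hg : IntersectingSubmodular g)
    (hg1 : ∀ v, g {v} = 0) {w : Fin k → Fin k → ℝ} (hw : Feasible g w)
    {b : ℝ} (hb : pairSum w Finset.univ ≤ b) {J : Finset (Fin k)} (hJ : J.Nonempty)
    (hsupp : ∀ T, J ⊆ T → pairSum w T = pairSum w Finset.univ)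
    (hbJ : ∀ T, J ⊆ T → b ≤ g T) :
    ∃ w' : Fin k → Fin k → ℝ, Feasible g w' ∧ (∀ i j, w i j ≤ w' i j) ∧
      ∀ T, J ⊆ T → pairSum w' T = b := by
  have key : ∀ P : Finset (Fin k × Fin k), (∀ e ∈ P, e.1 ∈ J ∧ e.2 ∈ J ∧ e.1 < e.2) →
      ∃ w' : Fin k → Fin k → ℝ, Feasible g w' ∧ (∀ i j, w i j ≤ w' i j) ∧
        (∀ T, J ⊆ T → pairSum w' T = pairSum w' Finset.univ) ∧
        pairSum w' Finset.univ ≤ b ∧ (pairSum w' Finset.univ = b ∨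
          ∀ e ∈ P, ∃ T : Finset (Fin k), e.1 ∈ T ∧ e.2 ∈ T ∧ pairSum w' T = g T) := by
    intro P
    induction P using Finset.induction_on with
    | empty => exact fun _ => ⟨w, hw, fun _ _ => le_rfl, hsupp, hb, .inr (by simp)⟩
    | insert e P _ ih =>
      intro hP
      obtain ⟨w₁, h1, h2, h3, h4, h5⟩ := ih fun e' he' => hP e' (Finset.mem_insert_of_mem he')
      obtain ⟨hu, hv, huv⟩ := hP e (Finset.mem_insert_self _ _)
      obtain ⟨t, ht0, hf, htb, hor⟩ := h1.raise_pair h4 huv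
      have htot : pairSum (fun i j => w₁ i j + singlePair e.1 e.2 t i j) Finset.univ
          = pairSum w₁ Finset.univ + t := by
        rw [pairSum_update huv, if_pos (by simp)]
      have hle : ∀ i j, w₁ i j ≤ w₁ i j + singlePair e.1 e.2 t i j := by
        intro i j
        unfold singlePair
        split_ifs <;> linarith
      refine ⟨_, hf, fun i j => (h2 i j).trans (hle i j), ?_, ?_, ?_⟩
      · intro T hT
        rw [htot, pairSum_update huv, if_pos ⟨hT hu, hT hv⟩, h3 T hT]
      · rw [htot]; exact htb
      · rw [htot]
        rcases hor with h | ⟨T, hT⟩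
        · exact .inl h
        · rcases h5 with h | h
          · left; linarith
          · right
            intro e' he'
            rcases Finset.mem_insert.1 he' with rfl | he'
            · exact ⟨T, hT⟩
            · obtain ⟨T', h1', h2', h3'⟩ := h e' he'
              -- A tight set stays tight: the weights only grow and remain feasible.
              refine ⟨T', h1', h2', le_antisymm (hf.le _ ⟨_, h1'⟩) ?_⟩
              rw [← h3']
              exact pairSum_mono fun i _ j _ _ => hle i j
  obtain ⟨w', h1, h2, h3, h4, h5⟩ := key
    ((J ×ˢ J).filter fun e => e.1 < e.2) (by simp +contextual)
  refine ⟨w', h1, h2, fun T hT => ?_⟩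
  rw [h3 T hT]
  rcases h5 with h | h
  · exact h
  · obtain ⟨x, hx⟩ := hJ
    -- If the total never reached `b`, every pair of `J` is blocked, so some `T' ⊇ J` is tight; it
    -- carries the whole weight, which is then `g T' ≥ b`.
    obtain ⟨T', hT', htight⟩ := h1.exists_tight_superset hg hg1 hx fun u hu v hv huv =>
      h (u, v) (by simp [hu, hv, huv])
    exact le_antisymm h4 (by rw [← h3 T' hT', htight]; exact hbJ T' hT')

/-- The first `l` indices in the order given by `r`. -/
def initialSet (r : Equiv.Perm (Fin k)) (l : ℕ) : Finset (Fin k) :=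
  Finset.univ.filter fun u => (r u : ℕ) < l

theorem initialSet_zero (r : Equiv.Perm (Fin k)) : initialSet r 0 = ∅ := by
  simp [initialSet]

theorem initialSet_self (r : Equiv.Perm (Fin k)) : initialSet r k = Finset.univ := by
  simp [initialSet]

theorem initialSet_mono (r : Equiv.Perm (Fin k)) {l l' : ℕ} (h : l ≤ l') :
    initialSet r l ⊆ initialSet r l' := by
  intro u hu
  simp only [initialSet, Finset.mem_filter, Finset.mem_univ, true_and] at hu ⊢
  omega

theorem notMem_initialSet (r : Equiv.Perm (Fin k)) {l : ℕ} (hl : l < k) :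
    r.symm ⟨l, hl⟩ ∉ initialSet r l := by
  simp [initialSet]

theorem initialSet_succ (r : Equiv.Perm (Fin k)) {l : ℕ} (hl : l < k) :
    initialSet r (l + 1) = insert (r.symm ⟨l, hl⟩) (initialSet r l) := by
  ext u
  simp only [initialSet, Finset.mem_filter, Finset.mem_univ, true_and, Finset.mem_insert,
    Equiv.eq_symm_apply, Fin.ext_iff]
  omega

theorem initialSet_nonempty (r : Equiv.Perm (Fin k)) {l : ℕ} (hl : l < k) :
    (initialSet r (l + 1)).Nonempty :=
  ⟨_, by rw [initialSet_succ r hl]; exact Finset.mem_insert_self _ _⟩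

/-- Along any ordering there are feasible weights meeting the demands `F` of all initial sets. -/
theorem exists_feasible_of_demand {g F : Finset (Fin k) → ℝ} (hg : IntersectingSubmodular g)
    (hg1 : ∀ v, g {v} = 0) (hF0 : ∀ T, 0 ≤ F T) (hF : Monotone F)
    (hFg : ∀ T : Finset (Fin k), T.Nonempty → F T ≤ g T) (hk : 0 < k) (r : Equiv.Perm (Fin k)) :
    ∃ w : Fin k → Fin k → ℝ, Feasible g w ∧ pairSum w Finset.univ = F Finset.univ ∧
      ∀ l < k, F (initialSet r (l + 1)) ≤ pairSum w (initialSet r (l + 1)) := by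
  have key : ∀ l < k, ∃ w : Fin k → Fin k → ℝ, Feasible g w ∧
      (∀ T, initialSet r (l + 1) ⊆ T → pairSum w T = F (initialSet r (l + 1))) ∧
      ∀ m ≤ l, F (initialSet r (m + 1)) ≤ pairSum w (initialSet r (m + 1)) := by
    intro l
    induction l with
    | zero =>
      intro hl
      have h0 : ∀ T, pairSum (fun _ _ : Fin k => (0 : ℝ)) T = 0 := by simp [pairSum]
      have hf : Feasible g (fun _ _ => 0) :=
        ⟨fun _ _ _ => le_rfl, fun T hT => by rw [h0]; exact (hF0 T).trans (hFg T hT)⟩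
      obtain ⟨w, h1, -, h3⟩ := hf.exists_raise hg hg1 (b := F (initialSet r 1))
        (by rw [h0]; exact hF0 _) (initialSet_nonempty r hl) (fun T _ => by rw [h0, h0])
        (fun T hT => (hF hT).trans (hFg T ((initialSet_nonempty r hl).mono hT)))
      refine ⟨w, h1, h3, fun m hm => ?_⟩
      obtain rfl : m = 0 := by omega
      exact (h3 _ subset_rfl).ge
    | succ l ih =>
      intro hl
      obtain ⟨w, h1, h2, h3⟩ := ih (by omega)
      have hsub := initialSet_mono r (show l + 1 ≤ l + 1 + 1 by omega)
      obtain ⟨w', h1', h2', h3'⟩ := h1.exists_raise hg hg1 (b := F (initialSet r (l + 1 + 1)))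
        (by rw [h2 _ (Finset.subset_univ _)]; exact hF hsub) (initialSet_nonempty r hl)
        (fun T hT => by rw [h2 T (hsub.trans hT), h2 _ (Finset.subset_univ _)])
        (fun T hT => (hF hT).trans (hFg T ((initialSet_nonempty r hl).mono hT)))
      refine ⟨w', h1', h3', fun m hm => ?_⟩
      rcases Nat.lt_or_ge l m with hm' | hm'
      · obtain rfl : m = l + 1 := by omega
        exact (h3' _ subset_rfl).ge
      · exact (h3 m hm').trans (pairSum_mono fun i _ j _ _ => h2' i j)
  obtain ⟨w, h1, h2, h3⟩ := key (k - 1) (by omega)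
  have hk1 : k - 1 + 1 = k := by omega
  rw [hk1, initialSet_self] at h2
  exact ⟨w, h1, h2 _ subset_rfl, fun l hl => h3 l (by omega)⟩

end Greedy

/-! ### Existence of the exponents `δ` for each ordering. -/

section Exponents

variable {k : ℕ}

/-- Capacity left for new pair weights: local integrability with `N` lowered to `N - ε`, and the
subset condition with a margin `ε * (k - #T)` that vanishes only for the full index set. -/
def residualCapacity (N ε : ℝ) (q : Fin k → ℝ) (α : Fin k → Fin k → ℝ) (T : Finset (Fin k)) : ℝ :=
  min ((N - ε) * ((T.card : ℝ) - 1)) (∑ i ∈ T, (q i + ε) - k * ε) - pairSum α T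

/-- Both terms of the minimum are modular, and by `hq` adding points raises the second by no more
than the first. In the mixed cases the union is therefore estimated by the second term and the
intersection by the first. -/
theorem residualCapacity_intersectingSubmodular {N ε : ℝ} {q : Fin k → ℝ}
    {α : Fin k → Fin k → ℝ} (hα : ∀ i j, i < j → 0 ≤ α i j) (hq : ∀ i, q i + ε ≤ N - ε) :
    IntersectingSubmodular (residualCapacity N ε q α) := by
  intro S T _
  have h1 := pairSum_supermodular hα S T
  have hc : ((S ∪ T).card : ℝ) + (S ∩ T).card = S.card + T.card := by
    exact_mod_cast Finset.card_union_add_card_inter S T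
  have hs := Finset.sum_union_inter (s₁ := S) (s₂ := T) (f := fun i => q i + ε)
  have hd : ∀ S T : Finset (Fin k), ∑ i ∈ S ∪ T, (q i + ε) - ∑ i ∈ T, (q i + ε)
      ≤ (N - ε) * ((S ∪ T).card - T.card : ℝ) := by
    intro S T
    have h2 := Finset.sum_sdiff (f := fun i => q i + ε) (Finset.subset_union_right (s₁ := S) (s₂ := T))
    have h3 := Finset.card_sdiff_add_card_eq_card (Finset.subset_union_right (s₁ := S) (s₂ := T))
    have h4 := Finset.sum_le_card_nsmul ((S ∪ T) \ T) (fun i => q i + ε) (N - ε) fun i _ => hq i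
    rw [nsmul_eq_mul] at h4
    have h5 : ((S ∪ T).card - T.card : ℝ) = ((S ∪ T) \ T).card := by
      rw [← h3]; push_cast; ring
    rw [h5]
    linarith
  have hST := hd S T
  have hTS := hd T S
  rw [Finset.union_comm T S] at hTS
  simp only [residualCapacity]
  have hc' : (N - ε) * ((S ∪ T).card : ℝ) + (N - ε) * (S ∩ T).card
      = (N - ε) * S.card + (N - ε) * T.card := by
    rw [← mul_add, hc, mul_add]
  have u1 := min_le_left ((N - ε) * (((S ∪ T).card : ℝ) - 1)) (∑ i ∈ S ∪ T, (q i + ε) - k * ε)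
  have u2 := min_le_right ((N - ε) * (((S ∪ T).card : ℝ) - 1)) (∑ i ∈ S ∪ T, (q i + ε) - k * ε)
  have i1 := min_le_left ((N - ε) * (((S ∩ T).card : ℝ) - 1)) (∑ i ∈ S ∩ T, (q i + ε) - k * ε)
  have i2 := min_le_right ((N - ε) * (((S ∩ T).card : ℝ) - 1)) (∑ i ∈ S ∩ T, (q i + ε) - k * ε)
  rcases min_choice ((N - ε) * ((S.card : ℝ) - 1)) (∑ i ∈ S, (q i + ε) - k * ε) with h | h <;>
  rcases min_choice ((N - ε) * ((T.card : ℝ) - 1)) (∑ i ∈ T, (q i + ε) - k * ε) with h' | h' <;>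
  rw [h, h'] <;> nlinarith

/-- The pair weights that bound one integration in the extra variable: the new exponents `α + δ`
satisfy the conditions for `k` points, and `δ` is large on every initial set of the ordering. -/
theorem exists_pair_weights (hk : 0 < k) {N : ℝ} {α : Fin k → Fin k → ℝ} {a P : Fin k → ℝ}
    (hα : ∀ i j, i < j → 0 ≤ α i j) (ha : ∀ i, 0 ≤ a i) (hP0 : ∀ i, 0 < P i)
    (hN : 0 < N)
    (h1 : ∀ T : Finset (Fin k), 2 ≤ T.card → pairSum α T < N * (T.card - 1))
    (h2 : ∀ T : Finset (Fin k), T.Nonempty → pairSum α T + ∑ i ∈ T, a i < N * T.card)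
    (h3 : ∀ T : Finset (Fin k), T.Nonempty → N * ∑ i ∈ T, P i + pairSum α T < N * T.card)
    (h4 : ∀ T : Finset (Fin k), T.Nonempty → T ≠ Finset.univ →
      N * ∑ i ∈ T, P i + (pairSum α T + ∑ i ∈ T, a i) < N * (T.card + 1))
    (h5 : N * ∑ i, P i + (pairSum α Finset.univ + ∑ i, a i) = N * (k + 1)) :
    0 < ∑ i, a i - N ∧ ∃ ε > 0, ∀ r : Equiv.Perm (Fin k), ∃ δ : Fin k → Fin k → ℝ,
      (∀ i j, i < j → 0 ≤ δ i j) ∧ pairSum δ Finset.univ = ∑ i, a i - N ∧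
      (∀ T : Finset (Fin k), 2 ≤ T.card → pairSum α T + pairSum δ T < N * (T.card - 1)) ∧
      (∀ T : Finset (Fin k), T.Nonempty → T ≠ Finset.univ →
        N * ∑ i ∈ T, P i + (pairSum α T + pairSum δ T) < N * T.card) ∧
      ∀ l < k, 0 ≤ N - ε * (∑ i, a i - N) - ∑ i ∈ initialSet r (l + 1), a i
        + (1 + ε) * pairSum δ (initialSet r (l + 1)) := by
  have huniv : (Finset.univ : Finset (Fin k)).Nonempty := ⟨⟨0, hk⟩, Finset.mem_univ _⟩
  have hcard : ((Finset.univ : Finset (Fin k)).card : ℝ) = k := by simp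
  set s := ∑ i, a i - N with hs_def
  have hs : 0 < s := by
    have := h3 _ huniv
    rw [hcard] at this
    linarith
  refine ⟨hs, ?_⟩
  set q : Fin k → ℝ := fun i => N * (1 - P i) with hq_def
  have hqsum : ∀ T : Finset (Fin k), ∑ i ∈ T, q i = N * T.card - N * ∑ i ∈ T, P i := by
    intro T
    simp only [hq_def, mul_sub, mul_one, Finset.sum_sub_distrib, Finset.mul_sum]
    simp [mul_comm]
  have hev : ∀ {x y : ℝ} (c d : ℝ), x < y → ∀ᶠ ε in nhdsWithin (0 : ℝ) (Set.Ioi 0),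
      x + ε * c < y + ε * d := by
    intro x y c d hxy
    refine Filter.Eventually.filter_mono nhdsWithin_le_nhds ?_
    refine ContinuousAt.eventually_lt (by fun_prop) (by fun_prop) (by simpa using hxy)
  -- At `ε = 0` these are the strict hypotheses. The first and last give `F ≤ g` on proper subsets,
  -- the middle two give `0 ≤ g`.
  have hA : ∀ᶠ ε in nhdsWithin (0 : ℝ) (Set.Ioi 0), ∀ T : Finset (Fin k), T.Nonempty →
      pairSum α T + ∑ i ∈ T, a i - N + ε * (s + (T.card - 1)) < N * (T.card - 1) + ε * 0 ∧
      (2 ≤ T.card → pairSum α T + ε * (T.card - 1) < N * (T.card - 1) + ε * 0) ∧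
      pairSum α T + ε * (k - T.card) < ∑ i ∈ T, q i + ε * 0 ∧
      (T ≠ Finset.univ → pairSum α T + ∑ i ∈ T, a i - N + ε * (s + (k - T.card))
        < ∑ i ∈ T, q i + ε * 0) := by
    refine Filter.eventually_all.2 fun T => ?_
    by_cases hT : T.Nonempty
    · simp only [hT, true_implies]
      refine (hev _ _ ?_).and (Filter.Eventually.and ?_ ((hev _ _ ?_).and ?_))
      · linarith [h2 T hT]
      · by_cases hc : 2 ≤ T.card
        · simp only [hc, true_implies]; exact hev _ _ (h1 T hc)
        · simp [hc]
      · rw [hqsum]; linarith [h3 T hT]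
      · by_cases hc : T = Finset.univ
        · simp [hc]
        · simp only [ne_eq, hc, not_false_eq_true, true_implies]
          refine hev _ _ ?_
          rw [hqsum]; linarith [h4 T hT hc]
    · simp [hT]
  -- Finiteness of the exponents `p_i` enters here: `P i > 0` gives `q i < N`, the slope comparison
  -- needed for submodularity.
  have hB : ∀ᶠ ε in nhdsWithin (0 : ℝ) (Set.Ioi 0), ∀ i, q i + ε * 1 < N + ε * (-1) := by
    refine Filter.eventually_all.2 fun i => hev _ _ ?_
    have := mul_pos hN (hP0 i)
    simp only [hq_def]; linarith
  obtain ⟨ε, ⟨hε1, hε2⟩, hε⟩ := ((hA.and hB).and self_mem_nhdsWithin).exists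
  refine ⟨ε, hε, fun r => ?_⟩
  set g := residualCapacity N ε q α with hg_def
  -- The demand is the last conclusion solved for the weight of `δ`.
  set F : Finset (Fin k) → ℝ := fun T => max 0 ((∑ i ∈ T, a i - N + ε * s) / (1 + ε)) with hF_def
  have hg : ∀ T, g T
      = min ((N - ε) * ((T.card : ℝ) - 1)) (∑ i ∈ T, q i - ε * (k - T.card)) - pairSum α T := by
    intro T
    rw [hg_def, residualCapacity, Finset.sum_add_distrib, Finset.sum_const, nsmul_eq_mul]
    congr 2
    ring
  have hgsub : IntersectingSubmodular g :=
    residualCapacity_intersectingSubmodular hα fun i => by linarith [hε2 i]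
  have hg1 : ∀ v, g {v} = 0 := by
    intro v
    obtain ⟨-, -, h, -⟩ := hε1 {v} (Finset.singleton_nonempty v)
    rw [pairSum_singleton] at h
    rw [hg, pairSum_singleton, Finset.card_singleton, min_eq_left]
    · simp
    · simp only [Finset.card_singleton] at h
      norm_num at h ⊢
      linarith
  have hFmono : Monotone F := by
    intro S T hST
    have := Finset.sum_le_sum_of_subset_of_nonneg hST fun i _ _ => ha i
    simp only [hF_def]
    gcongr
  have hFs : F Finset.univ = s := by
    have : (∑ i, a i - N + ε * s) / (1 + ε) = s := by
      rw [← hs_def]; field_simp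
    simp only [hF_def]
    rw [this, max_eq_right hs.le]
  have hFg : ∀ T : Finset (Fin k), T.Nonempty → F T ≤ g T := by
    intro T hT
    obtain ⟨e1, e2, e3, e4⟩ := hε1 T hT
    have hg0 : 0 ≤ g T := by
      rw [hg, sub_nonneg]
      refine le_min ?_ (by linarith)
      rcases Nat.lt_or_ge T.card 2 with hc | hc
      · obtain ⟨v, rfl⟩ := Finset.card_eq_one.1 (le_antisymm (by omega) hT.card_pos)
        simp [pairSum_singleton]
      · linarith [e2 hc]
    -- On the full set the scaling identity `h5` makes the second bound exactly `s`, with no slack;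
    -- this is why the margin has the factor `k - #T`.
    by_cases hTu : T = Finset.univ
    · subst hTu
      rw [hFs, hg, le_sub_iff_add_le]
      have := mul_pos hε hs
      refine le_min (by linarith) ?_
      rw [hqsum, hcard]
      linarith
    · refine max_le hg0 ?_
      rw [div_le_iff₀ (by linarith)]
      have h6 : ∑ i ∈ T, a i - N + ε * s ≤ g T := by
        rw [hg, le_sub_iff_add_le]
        exact le_min (by linarith) (by linarith [e4 hTu])
      nlinarith
  obtain ⟨δ, hδ, hδs, hδF⟩ := exists_feasible_of_demand hgsub hg1 (fun T => le_max_left _ _) hFmono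
    hFg hk r
  refine ⟨δ, hδ.nonneg, hδs.trans hFs, fun T hT => ?_, fun T hT hTu => ?_, fun l hl => ?_⟩
  · have h6 := hδ.le T (Finset.card_pos.1 (zero_lt_two.trans_le hT))
    rw [hg, le_sub_iff_add_le, le_min_iff] at h6
    have : (2 : ℝ) ≤ T.card := by exact_mod_cast hT
    nlinarith [h6.1]
  · have h6 := hδ.le T hT
    rw [hg, le_sub_iff_add_le, le_min_iff, hqsum] at h6
    have : (T.card : ℝ) < k := by
      have := Finset.card_lt_card (Finset.ssubset_univ_iff.2 hTu)
      rw [Finset.card_univ, Fintype.card_fin] at this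
      exact_mod_cast this
    nlinarith [h6.2]
  · have h6 := (le_max_right _ _).trans (hδF l hl)
    rw [div_le_iff₀ (by linarith)] at h6
    linarith

end Exponents

/-! ### Pointwise bound of the integrand for a fixed ordering. -/

section Pointwise

variable {k n : ℕ}

/-- Summation by parts. The nonnegative coefficient gathered on an initial set may be moved to the
next, larger value of `t`; for a new last point every maximum is its own `t`. The final coefficient
is zero, so the signs of `t` do not matter. -/
theorem sum_mul_le_of_monotone (hk : 0 < k) (r : Equiv.Perm (Fin k)) {t : Fin k → ℝ}
    (ht : Monotone (t ∘ r.symm)) (a : Fin k → ℝ) (w : Fin k → Fin k → ℝ) (c : ℝ)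
    (hl : ∀ l < k, 0 ≤ c - ∑ i ∈ initialSet r (l + 1), a i + pairSum w (initialSet r (l + 1)))
    (htot : c - ∑ i, a i + pairSum w Finset.univ = 0) :
    c * t (r.symm ⟨0, hk⟩) - ∑ i, a i * t i
      + pairSum (fun i j => w i j * max (t i) (t j)) Finset.univ ≤ 0 := by
  have key : ∀ l (hl : l < k), c * t (r.symm ⟨0, hk⟩) - ∑ i ∈ initialSet r (l + 1), a i * t i
      + pairSum (fun i j => w i j * max (t i) (t j)) (initialSet r (l + 1))
      ≤ (c - ∑ i ∈ initialSet r (l + 1), a i + pairSum w (initialSet r (l + 1)))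
        * t (r.symm ⟨l, hl⟩) := by
    intro l
    induction l with
    | zero =>
      intro hl0
      rw [initialSet_succ r hl0, initialSet_zero]
      simp only [insert_empty_eq, Finset.sum_singleton, pairSum_singleton]
      linarith
    | succ l ih =>
      intro hl1
      have hl0 : l < k := by omega
      have h1 := ih hl0
      have h2 : t (r.symm ⟨l, hl0⟩) ≤ t (r.symm ⟨l + 1, hl1⟩) :=
        ht (Fin.mk_le_mk.2 (Nat.le_succ l))
      have h3 := mul_le_mul_of_nonneg_left h2 (hl l hl0)
      have hn := notMem_initialSet r hl1
      have h4 : ∑ u ∈ initialSet r (l + 1), w (min u (r.symm ⟨l + 1, hl1⟩))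
            (max u (r.symm ⟨l + 1, hl1⟩)) * max (t (min u (r.symm ⟨l + 1, hl1⟩)))
              (t (max u (r.symm ⟨l + 1, hl1⟩)))
          = (∑ u ∈ initialSet r (l + 1), w (min u (r.symm ⟨l + 1, hl1⟩))
            (max u (r.symm ⟨l + 1, hl1⟩))) * t (r.symm ⟨l + 1, hl1⟩) := by
        rw [Finset.sum_mul]
        refine Finset.sum_congr rfl fun u hu => ?_
        congr 1
        have hut : t u ≤ t (r.symm ⟨l + 1, hl1⟩) := by
          have := @ht (r u) ⟨l + 1, hl1⟩ (by
            simp only [initialSet, Finset.mem_filter] at hu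
            exact Fin.le_def.2 hu.2.le)
          simpa using this
        rcases le_total u (r.symm ⟨l + 1, hl1⟩) with h | h
        · rw [min_eq_left h, max_eq_right h, max_eq_right hut]
        · rw [min_eq_right h, max_eq_left h, max_eq_left hut]
      rw [initialSet_succ r hl1, Finset.sum_insert hn, Finset.sum_insert hn, pairSum_insert _ hn,
        pairSum_insert _ hn, h4]
      linarith
  have h := key (k - 1) (by omega)
  have hk1 : k - 1 + 1 = k := by omega
  rw [hk1, initialSet_self, htot, zero_mul] at h
  exact h

theorem enorm_rpow_eq_ofReal_exp {E : Type*} [NormedAddCommGroup E] {v : E} (hv : v ≠ 0) (z : ℝ) :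
    ‖v‖ₑ ^ z = ENNReal.ofReal (Real.exp (z * Real.log ‖v‖)) := by
  have h : 0 < ‖v‖ := norm_pos_iff.2 hv
  rw [← ofReal_norm, ENNReal.ofReal_rpow_of_pos h, Real.rpow_def_of_pos h, mul_comm]

theorem ofReal_exp_sum {ι : Type*} (s : Finset ι) (f : ι → ℝ) :
    ENNReal.ofReal (Real.exp (∑ i ∈ s, f i)) = ∏ i ∈ s, ENNReal.ofReal (Real.exp (f i)) := by
  rw [Real.exp_sum, ENNReal.ofReal_prod_of_nonneg fun _ _ => (Real.exp_pos _).le]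

theorem ofReal_exp_le_correlationKernel {δ : Fin k → Fin k → ℝ}
    (hδ : ∀ i j, i < j → 0 ≤ δ i j) {x : Fin k → EuclideanSpace ℝ (Fin n)}
    {y : EuclideanSpace ℝ (Fin n)} (hy : ∀ i, x i - y ≠ 0) :
    ENNReal.ofReal (Real.exp (-(Real.log 2 * pairSum δ Finset.univ +
      pairSum (fun i j => δ i j * max (Real.log ‖x i - y‖) (Real.log ‖x j - y‖)) Finset.univ)))
      ≤ correlationKernel δ x := by
  rw [← pairSum_mul_left, ← pairSum_add, pairSum, ← Finset.sum_neg_distrib]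
  simp only [← Finset.sum_neg_distrib]
  rw [ofReal_exp_sum, correlationKernel]
  refine Finset.prod_le_prod' fun i _ => ?_
  rw [ofReal_exp_sum]
  refine Finset.prod_le_prod' fun j hj => ?_
  have hij := (Finset.mem_filter.1 hj).2
  have hi : 0 < ‖x i - y‖ := norm_pos_iff.2 (hy i)
  have hj : 0 < ‖x j - y‖ := norm_pos_iff.2 (hy j)
  set M := max (Real.log ‖x i - y‖) (Real.log ‖x j - y‖)
  have h1 : ‖x i - x j‖ ≤ Real.exp (Real.log 2 + M) := by
    have e1 : ‖x i - y‖ ≤ Real.exp M := by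
      rw [← Real.log_le_iff_le_exp hi]; exact le_max_left _ _
    have e2 : ‖x j - y‖ ≤ Real.exp M := by
      rw [← Real.log_le_iff_le_exp hj]; exact le_max_right _ _
    have e3 : ‖x i - x j‖ ≤ ‖x i - y‖ + ‖x j - y‖ := by
      have := norm_sub_le (x i - y) (x j - y)
      rwa [sub_sub_sub_cancel_right] at this
    rw [Real.exp_add, Real.exp_log two_pos]
    linarith
  have h2 : ‖x i - x j‖ₑ ≤ ENNReal.ofReal (Real.exp (Real.log 2 + M)) := by
    rw [← ofReal_norm]; exact ENNReal.ofReal_le_ofReal h1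
  calc ENNReal.ofReal (Real.exp (-(Real.log 2 * δ i j + δ i j * M)))
      = ENNReal.ofReal (Real.exp (Real.log 2 + M)) ^ (-(δ i j)) := by
        rw [ENNReal.ofReal_rpow_of_pos (Real.exp_pos _), ← Real.exp_mul]
        congr 2; ring
    _ ≤ _ := by
        rw [ENNReal.rpow_neg, ENNReal.rpow_neg]
        exact ENNReal.inv_le_inv' (ENNReal.rpow_le_rpow h2 (hδ i j hij))

/-- If `|x_i - y|` increases along the ordering `r`, the product of the `|x_i - y| ^ (-a_i)` is
bounded by a kernel concentrated near `|x_0 - y| ≈ K ^ (-1 / s)`, `x_0` the first point. -/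
theorem prod_enorm_rpow_le (hk : 0 < k) (r : Equiv.Perm (Fin k)) {a : Fin k → ℝ}
    (ha : ∀ i, 0 ≤ a i) {δ : Fin k → Fin k → ℝ} (hδ : ∀ i j, i < j → 0 ≤ δ i j) {N s ε : ℝ}
    (hε : 0 < ε) (has : ∑ i, a i = N + s) (hδs : pairSum δ Finset.univ = s)
    (hl : ∀ l < k, 0 ≤ N - ε * s - ∑ i ∈ initialSet r (l + 1), a i
        + (1 + ε) * pairSum δ (initialSet r (l + 1)))
    {x : Fin k → EuclideanSpace ℝ (Fin n)} {y : EuclideanSpace ℝ (Fin n)}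
    (hy : ∀ i, x i - y ≠ 0) (hr : Monotone ((fun i => Real.log ‖x i - y‖) ∘ r.symm)) :
    ∏ i, ‖x i - y‖ₑ ^ (-(a i)) ≤
      min (ENNReal.ofReal (Real.exp (Real.log 2 * ((1 + ε) * s))) *
          (‖x (r.symm ⟨0, hk⟩) - y‖ₑ ^ (-(N - ε * s)) * correlationKernel δ x ^ (1 + ε)))
        (‖x (r.symm ⟨0, hk⟩) - y‖ₑ ^ (-(N + s))) := by
  set t : Fin k → ℝ := fun i => Real.log ‖x i - y‖ with ht
  have hprod : ∏ i, ‖x i - y‖ₑ ^ (-(a i))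
      = ENNReal.ofReal (Real.exp (-∑ i, a i * t i)) := by
    rw [← Finset.sum_neg_distrib, ofReal_exp_sum]
    refine Finset.prod_congr rfl fun i _ => ?_
    rw [enorm_rpow_eq_ofReal_exp (hy i), neg_mul]
  rw [hprod]
  refine le_min ?_ ?_
  · have hK := ENNReal.rpow_le_rpow (ofReal_exp_le_correlationKernel hδ hy)
      (show (0 : ℝ) ≤ 1 + ε by linarith)
    rw [ENNReal.ofReal_rpow_of_pos (Real.exp_pos _), ← Real.exp_mul, hδs] at hK
    have hmain := sum_mul_le_of_monotone hk r hr a (fun i j => (1 + ε) * δ i j) (N - ε * s)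
      (fun l h => by rw [pairSum_mul_left]; exact hl l h)
      (by rw [pairSum_mul_left, has, hδs]; ring)
    simp only [mul_assoc] at hmain
    rw [pairSum_mul_left] at hmain
    refine le_trans ?_ (mul_le_mul_right (mul_le_mul_right hK _) _)
    rw [enorm_rpow_eq_ofReal_exp (hy _), ← ENNReal.ofReal_mul (Real.exp_pos _).le,
      ← ENNReal.ofReal_mul (Real.exp_pos _).le, ← Real.exp_add, ← Real.exp_add]
    refine ENNReal.ofReal_le_ofReal (Real.exp_le_exp.2 ?_)
    simp only [ht] at hmain ⊢
    linarith
  · rw [enorm_rpow_eq_ofReal_exp (hy _)]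
    refine ENNReal.ofReal_le_ofReal (Real.exp_le_exp.2 ?_)
    have : ∑ i, a i * t (r.symm ⟨0, hk⟩) ≤ ∑ i, a i * t i := by
      refine Finset.sum_le_sum fun i _ => mul_le_mul_of_nonneg_left ?_ (ha i)
      have := @hr ⟨0, hk⟩ (r i) (Fin.le_def.2 (Nat.zero_le _))
      simpa using this
    rw [← Finset.sum_mul, has] at this
    rw [neg_mul]
    exact neg_le_neg this

end Pointwise

/-! ### The radial integral and its scaling. -/

section RadialIntegral

variable {n : ℕ}

/-- In polar coordinates the first power becomes `t ^ (-1 + θ)`, integrable at `0`, and the second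
`t ^ (-1 - s)`, integrable at infinity. -/
theorem integrable_min_norm_rpow (hn : 0 < n) {θ s : ℝ} (hθ : 0 < θ) (hs : 0 < s) :
    Integrable fun z : EuclideanSpace ℝ (Fin n) =>
      min (‖z‖ ^ (-((n : ℝ) - θ))) (‖z‖ ^ (-((n : ℝ) + s))) := by
  have : Nonempty (Fin n) := ⟨⟨0, hn⟩⟩
  have hpow : ∀ {t : ℝ} (_ : 0 < t) (b : ℝ),
      t ^ (n - 1) * t ^ (-((n : ℝ) + b)) = t ^ (-1 - b) := by
    intro t ht b
    rw [← Real.rpow_natCast, ← Real.rpow_add ht, Nat.cast_sub hn]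
    congr 1; push_cast; ring
  have hmeas : Measurable fun t : ℝ =>
      t ^ (n - 1) * min (t ^ (-((n : ℝ) - θ))) (t ^ (-((n : ℝ) + s))) := by fun_prop
  rw [integrable_fun_norm_addHaar (μ := (volume : Measure (EuclideanSpace ℝ (Fin n))))
    (f := fun t : ℝ => min (t ^ (-((n : ℝ) - θ))) (t ^ (-((n : ℝ) + s))))]
  simp only [finrank_euclideanSpace, Fintype.card_fin, smul_eq_mul]
  rw [← Set.Ioc_union_Ioi_eq_Ioi (zero_le_one' ℝ), integrableOn_union]
  constructor
  · have h1 : IntegrableOn (fun t : ℝ => t ^ (-1 + θ)) (Set.Ioc 0 1) := by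
      rw [← intervalIntegrable_iff_integrableOn_Ioc_of_le zero_le_one]
      exact intervalIntegral.intervalIntegrable_rpow' (by linarith)
    refine Integrable.mono' h1 hmeas.aestronglyMeasurable ?_
    filter_upwards [ae_restrict_mem measurableSet_Ioc] with t ht
    have := hpow ht.1 (-θ)
    rw [sub_neg_eq_add, ← sub_eq_add_neg] at this
    have h0 := ht.1
    rw [← this, Real.norm_of_nonneg (by positivity)]
    gcongr
    exact min_le_left _ _
  · have h1 : IntegrableOn (fun t : ℝ => t ^ (-1 - s)) (Set.Ioi 1) :=
      integrableOn_Ioi_rpow_of_lt (by linarith) zero_lt_one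
    refine Integrable.mono' h1 hmeas.aestronglyMeasurable ?_
    filter_upwards [ae_restrict_mem measurableSet_Ioi] with t ht
    have h0 : 0 < t := zero_lt_one.trans ht
    rw [← hpow h0 s, Real.norm_of_nonneg (by positivity)]
    gcongr
    exact min_le_right _ _

theorem exists_lintegral_min_le (hn : 0 < n) {ε s : ℝ} (hε : 0 < ε) (hs : 0 < s) :
    ∃ H : ℝ≥0, ∀ (x₀ : EuclideanSpace ℝ (Fin n)) (K : ℝ≥0∞), K ≠ 0 →
      ∫⁻ y, min (‖x₀ - y‖ₑ ^ (-((n : ℝ) - ε * s)) * K ^ (1 + ε)) (‖x₀ - y‖ₑ ^ (-((n : ℝ) + s)))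
        ≤ H * K := by
  have : Nonempty (Fin n) := ⟨⟨0, hn⟩⟩
  set φ : EuclideanSpace ℝ (Fin n) → ℝ :=
    fun z => min (‖z‖ ^ (-((n : ℝ) - ε * s))) (‖z‖ ^ (-((n : ℝ) + s))) with hφ
  have hint : Integrable φ := integrable_min_norm_rpow hn (mul_pos hε hs) hs
  have hφ0 : ∀ z, 0 ≤ φ z := fun z => by positivity
  -- The added `1` keeps the constant nonzero, so that the bound is `⊤` when `K = ⊤`.
  refine ⟨(∫ z, φ z).toNNReal + 1, fun x₀ K hK => ?_⟩
  rcases eq_or_ne K ⊤ with rfl | hKt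
  · rw [ENNReal.mul_top (by simp)]; exact le_top
  have hKr : 0 < K.toReal := ENNReal.toReal_pos hK hKt
  -- The distance at which the two powers agree; rescaling by `D` leaves the factor `D ^ (-(n + s))
  -- * D ^ n = D ^ (-s) = K`.
  set D : ℝ := K.toReal ^ (-(1 / s)) with hD
  have hD0 : 0 < D := Real.rpow_pos_of_pos hKr _
  have hKD : ∀ b : ℝ, K ^ b = ENNReal.ofReal (D ^ (-(s * b))) := by
    intro b
    rw [hD, ← Real.rpow_mul hKr.le, ← ENNReal.ofReal_toReal hKt, ENNReal.ofReal_rpow_of_pos hKr,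
      ENNReal.toReal_ofReal hKr.le]
    congr 2; field_simp
  have hcongr : ∀ᵐ y : EuclideanSpace ℝ (Fin n),
      min (‖x₀ - y‖ₑ ^ (-((n : ℝ) - ε * s)) * K ^ (1 + ε)) (‖x₀ - y‖ₑ ^ (-((n : ℝ) + s)))
        = ENNReal.ofReal (D ^ (-((n : ℝ) + s)) * φ (D⁻¹ • (x₀ - y))) := by
    have : ∀ᵐ y : EuclideanSpace ℝ (Fin n), y ≠ x₀ := by
      simp [ae_iff, measure_singleton]
    filter_upwards [this] with y hy
    have hρ : 0 < ‖x₀ - y‖ := norm_pos_iff.2 (sub_ne_zero.2 hy.symm)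
    rw [hKD, ← ofReal_norm, ENNReal.ofReal_rpow_of_pos hρ, ENNReal.ofReal_rpow_of_pos hρ,
      ← ENNReal.ofReal_mul (by positivity), ← ENNReal.ofReal_min]
    congr 1
    simp only [hφ]
    rw [norm_smul, norm_inv, Real.norm_of_nonneg hD0.le, mul_min_of_nonneg _ _ (by positivity),
      Real.mul_rpow (by positivity) hρ.le, Real.mul_rpow (by positivity) hρ.le,
      Real.inv_rpow hD0.le, Real.inv_rpow hD0.le, ← Real.rpow_neg hD0.le, ← Real.rpow_neg hD0.le,
      ← mul_assoc, ← mul_assoc, ← Real.rpow_add hD0, ← Real.rpow_add hD0]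
    congr 1
    · rw [mul_comm]; congr 2; ring
    · simp
  have hint' : Integrable fun y => φ (D⁻¹ • (x₀ - y)) :=
    (hint.comp_smul (inv_ne_zero hD0.ne')).comp_sub_left x₀
  have hval : ∫ y, φ (D⁻¹ • (x₀ - y)) = D ^ n * ∫ z, φ z := by
    rw [integral_sub_left_eq_self (fun y => φ (D⁻¹ • y)) volume x₀,
      Measure.integral_comp_inv_smul_of_nonneg volume φ hD0.le]
    simp
  rw [lintegral_congr_ae hcongr, ← ofReal_integral_eq_lintegral_ofReal (hint'.const_mul _)
    (.of_forall fun y => mul_nonneg (by positivity) (hφ0 _)), integral_const_mul, hval, ← mul_assoc]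
  have hK1 : K = ENNReal.ofReal (D ^ (-s)) := by simpa using hKD 1
  have hDD : D ^ (-((n : ℝ) + s)) * D ^ n = D ^ (-s) := by
    rw [← Real.rpow_natCast, ← Real.rpow_add hD0]; congr 1; ring
  rw [hDD, ENNReal.ofReal_mul (by positivity), ← hK1, mul_comm]
  gcongr
  rw [ENNReal.ofReal]
  exact_mod_cast le_self_add

end RadialIntegral

/-! ### Kernels and the integral in the extra variable. -/

section Kernels

variable {k n : ℕ}

theorem correlationKernel_ne_zero {δ : Fin k → Fin k → ℝ} (hδ : ∀ i j, i < j → 0 ≤ δ i j)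
    (x : Fin k → EuclideanSpace ℝ (Fin n)) : correlationKernel δ x ≠ 0 := by
  refine Finset.prod_ne_zero_iff.2 fun i _ => Finset.prod_ne_zero_iff.2 fun j hj => ?_
  rw [ENNReal.rpow_neg]
  exact ENNReal.inv_ne_zero.2
    (ENNReal.rpow_ne_top_of_nonneg (hδ i j (Finset.mem_filter.1 hj).2) enorm_ne_top)

theorem measurable_correlationKernel (δ : Fin k → Fin k → ℝ) :
    Measurable fun x : Fin k → EuclideanSpace ℝ (Fin n) => correlationKernel δ x := by
  unfold correlationKernel
  fun_prop

theorem correlationKernel_mul {v w : Fin k → Fin k → ℝ} (hv : ∀ i j, i < j → 0 ≤ v i j)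
    (hw : ∀ i j, i < j → 0 ≤ w i j) (x : Fin k → EuclideanSpace ℝ (Fin n)) :
    correlationKernel v x * correlationKernel w x
      = correlationKernel (fun i j => v i j + w i j) x := by
  simp only [correlationKernel, ← Finset.prod_mul_distrib]
  refine Finset.prod_congr rfl fun i _ => Finset.prod_congr rfl fun j hj => ?_
  have hij := (Finset.mem_filter.1 hj).2
  simp only [ENNReal.rpow_neg, ← ENNReal.inv_rpow]
  rw [ENNReal.rpow_add_of_nonneg _ _ (hv i j hij) (hw i j hij)]

theorem correlationKernel_succ (α : Fin (k + 1) → Fin (k + 1) → ℝ)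
    (z : Fin (k + 1) → EuclideanSpace ℝ (Fin n)) :
    correlationKernel α z
      = correlationKernel (fun i j : Fin k => α i.castSucc j.castSucc) (fun i => z i.castSucc)
        * ∏ i : Fin k, ‖z i.castSucc - z (Fin.last k)‖ₑ ^ (-(α i.castSucc (Fin.last k))) := by
  have hlast : ∀ j : Fin k, ¬ Fin.last k < j.castSucc := fun j => (Fin.castSucc_lt_last j).not_gt
  simp only [correlationKernel, Finset.prod_filter, Fin.prod_univ_castSucc, Fin.castSucc_lt_last,
    if_true, hlast, if_false, Fin.castSucc_lt_castSucc_iff, lt_irrefl, Finset.prod_const_one,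
    mul_one, Finset.prod_mul_distrib]

theorem lintegral_prod_enorm_rpow_le (hn : 0 < n) (hk : 0 < k) {a : Fin k → ℝ}
    (ha : ∀ i, 0 ≤ a i) {s ε : ℝ} (hs : 0 < s) (hε : 0 < ε) (has : ∑ i, a i = n + s)
    {δ : Equiv.Perm (Fin k) → Fin k → Fin k → ℝ} (hδ : ∀ r i j, i < j → 0 ≤ δ r i j)
    (hδs : ∀ r, pairSum (δ r) Finset.univ = s)
    (hl : ∀ r, ∀ l < k, 0 ≤ n - ε * s - ∑ i ∈ initialSet r (l + 1), a i
        + (1 + ε) * pairSum (δ r) (initialSet r (l + 1))) :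
    ∃ M : ℕ, ∀ x : Fin k → EuclideanSpace ℝ (Fin n),
      ∫⁻ y, ∏ i, ‖x i - y‖ₑ ^ (-(a i)) ≤ M * ∑ r, correlationKernel (δ r) x := by
  have : Nonempty (Fin n) := ⟨⟨0, hn⟩⟩
  obtain ⟨H, hH⟩ := exists_lintegral_min_le hn hε hs
  set c : ℝ≥0 := (Real.exp (Real.log 2 * ((1 + ε) * s))).toNNReal with hc
  -- The pointwise bound has `c` on one branch of the minimum only; `1 ≤ c` allows it on both.
  have hc1 : (1 : ℝ≥0∞) ≤ c := by
    rw [hc, ← ENNReal.ofReal, ENNReal.one_le_ofReal, Real.one_le_exp_iff]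
    have := Real.log_pos one_lt_two
    positivity
  obtain ⟨M, hM⟩ := exists_nat_ge (c * H)
  refine ⟨M, fun x => ?_⟩
  set G : Equiv.Perm (Fin k) → EuclideanSpace ℝ (Fin n) → ℝ≥0∞ := fun r y =>
    min (‖x (r.symm ⟨0, hk⟩) - y‖ₑ ^ (-((n : ℝ) - ε * s)) * correlationKernel (δ r) x ^ (1 + ε))
      (‖x (r.symm ⟨0, hk⟩) - y‖ₑ ^ (-((n : ℝ) + s))) with hG
  have hGm : ∀ r, Measurable (G r) := fun r => by simp only [hG]; fun_prop
  have hpt : ∀ᵐ y : EuclideanSpace ℝ (Fin n),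
      ∏ i, ‖x i - y‖ₑ ^ (-(a i)) ≤ ∑ r, c * G r y := by
    have : ∀ᵐ y : EuclideanSpace ℝ (Fin n), ∀ i, y ≠ x i := by
      rw [ae_all_iff]
      intro i
      simp [ae_iff, measure_singleton]
    filter_upwards [this] with y hy
    set t : Fin k → ℝ := fun i => Real.log ‖x i - y‖
    have hsort := Tuple.monotone_sort t
    -- `Tuple.sort t` sends ranks to points, so its inverse is the ordering `r`. Summing over all
    -- orderings avoids a measurable partition of the `y`-space.
    refine le_trans ?_ (Finset.single_le_sum (f := fun r => (c : ℝ≥0∞) * G r y)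
      (fun _ _ => zero_le) (Finset.mem_univ (Tuple.sort t).symm))
    refine (prod_enorm_rpow_le hk (Tuple.sort t).symm ha (hδ _) hε has (hδs _) (hl _)
      (fun i => sub_ne_zero.2 (hy i).symm) (by simpa using hsort)).trans ?_
    simp only [hG, mul_min]
    exact min_le_min le_rfl (le_mul_of_one_le_left zero_le hc1)
  calc ∫⁻ y, ∏ i, ‖x i - y‖ₑ ^ (-(a i)) ≤ ∫⁻ y, ∑ r, c * G r y := lintegral_mono_ae hpt
    _ = ∑ r, c * ∫⁻ y, G r y := by
        rw [lintegral_finsetSum _ fun r _ => (hGm r).const_mul _]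
        exact Finset.sum_congr rfl fun r _ => lintegral_const_mul _ (hGm r)
    _ ≤ ∑ r, M * correlationKernel (δ r) x := by
        refine Finset.sum_le_sum fun r _ => ?_
        calc (c : ℝ≥0∞) * ∫⁻ y, G r y ≤ c * (H * correlationKernel (δ r) x) := by
              gcongr
              exact hH _ _ (correlationKernel_ne_zero (hδ r) x)
          _ = ((c * H : ℝ≥0) : ℝ≥0∞) * correlationKernel (δ r) x := by push_cast; ring
          _ ≤ M * correlationKernel (δ r) x := by
              gcongr
              exact_mod_cast hM
    _ = M * ∑ r, correlationKernel (δ r) x := by rw [Finset.mul_sum]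

end Kernels

/-! ### Separating the last point from the first `k`. -/

section Reindexing

variable {k n : ℕ}

theorem pairSum_map_castSucc (α : Fin (k + 1) → Fin (k + 1) → ℝ) (T : Finset (Fin k)) :
    pairSum α (T.map Fin.castSuccEmb)
      = pairSum (fun i j : Fin k => α i.castSucc j.castSucc) T := by
  simp [pairSum, Finset.sum_map, Finset.sum_filter]

theorem last_notMem_map_castSucc (T : Finset (Fin k)) :
    Fin.last k ∉ T.map Fin.castSuccEmb := by
  simp [Fin.castSucc_ne_last]

theorem pairSum_insert_last (α : Fin (k + 1) → Fin (k + 1) → ℝ) (T : Finset (Fin k)) :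
    pairSum α (insert (Fin.last k) (T.map Fin.castSuccEmb))
      = pairSum (fun i j : Fin k => α i.castSucc j.castSucc) T
        + ∑ i ∈ T, α i.castSucc (Fin.last k) := by
  rw [pairSum_insert _ (last_notMem_map_castSucc T), pairSum_map_castSucc, Finset.sum_map]
  congr 1
  refine Finset.sum_congr rfl fun i _ => ?_
  simp [min_eq_left (Fin.le_last _), max_eq_right (Fin.le_last _)]

theorem recipSum_map_castSucc (p : Fin (k + 1) → ℝ≥0∞) (T : Finset (Fin k)) :
    recipSum p (T.map Fin.castSuccEmb) = recipSum (fun i : Fin k => p i.castSucc) T := by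
  simp [recipSum, Finset.sum_map]

theorem recipSum_insert_last {p : Fin (k + 1) → ℝ≥0∞} (hp : p (Fin.last k) = ∞)
    (T : Finset (Fin k)) :
    recipSum p (insert (Fin.last k) (T.map Fin.castSuccEmb))
      = recipSum (fun i : Fin k => p i.castSucc) T := by
  rw [recipSum, Finset.sum_insert (last_notMem_map_castSucc T), ← recipSum,
    recipSum_map_castSucc, hp]
  simp

theorem card_insert_last (T : Finset (Fin k)) :
    (insert (Fin.last k) (T.map Fin.castSuccEmb)).card = T.card + 1 := by
  rw [Finset.card_insert_of_notMem (last_notMem_map_castSucc T), Finset.card_map]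

theorem insert_last_eq_univ_iff {T : Finset (Fin k)} :
    insert (Fin.last k) (T.map Fin.castSuccEmb) = Finset.univ ↔ T = Finset.univ := by
  rw [← Finset.card_eq_iff_eq_univ, ← Finset.card_eq_iff_eq_univ, card_insert_last]
  simp

/-- This half of Tonelli's theorem needs no measurability of `F`. -/
theorem lintegral_succ_le (F : (Fin (k + 1) → EuclideanSpace ℝ (Fin n)) → ℝ≥0∞) :
    ∫⁻ z, F z ≤ ∫⁻ x : Fin k → EuclideanSpace ℝ (Fin n), ∫⁻ y, F (Fin.snoc x y) := by
  have hmp := (volume_preserving_piFinSuccAbove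
    (fun _ : Fin (k + 1) => EuclideanSpace ℝ (Fin n)) (Fin.last k)).symm
  rw [← hmp.lintegral_comp_emb (MeasurableEquiv.measurableEmbedding _) F]
  rw [Measure.volume_eq_prod, ← lintegral_prod_swap]
  refine (lintegral_prod_le _).trans (le_of_eq ?_)
  simp [MeasurableEquiv.piFinSuccAbove, Fin.insertNthEquiv, Fin.insertNth_last']

end Reindexing

/-- The constant may be taken to be `1`: the constant of the kernel estimate depends on how far the
strict inequalities in the hypotheses are from equality, which is unavoidable (when `a` sums to `n`
over a cluster of points, the integral has a logarithm), and is absorbed by repeating exponents. -/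
theorem mainTheorem5 (n k : ℕ) (hn : 0 < n) (a : Fin k → ℝ) :
    ∃ C : ℝ≥0, 0 < C ∧
      ∀ (α : Fin (k + 1) → Fin (k + 1) → ℝ) (p : Fin (k + 1) → ℝ≥0∞),
        (∀ i : Fin k, α i.castSucc (Fin.last k) = a i) →
        (∀ i j, i < j → 0 ≤ α i j) →
        (∀ i : Fin k, 1 < p i.castSucc ∧ p i.castSucc < ∞) →
        p (Fin.last k) = ∞ →
        ScalingCondition n α p →
        LocalIntegrabilityCondition n α →
        StrictSubsetCondition n α p →
        ∃ (Δ : Type) (_ : Fintype Δ) (β : Δ → Fin k → Fin k → ℝ),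
          (∀ t : Δ,
            (∀ i j, i < j → 0 ≤ β t i j) ∧
            ScalingCondition n (β t) (fun i : Fin k => p i.castSucc) ∧
            LocalIntegrabilityCondition n (β t) ∧
            StrictSubsetCondition n (β t) (fun i : Fin k => p i.castSucc)) ∧
          ∀ f : Fin k → EuclideanSpace ℝ (Fin n) → ℂ,
            (∀ i, AEStronglyMeasurable (f i) volume) →
            (∫⁻ x : Fin (k + 1) → EuclideanSpace ℝ (Fin n),
                (∏ i : Fin k, ‖f i (x i.castSucc)‖ₑ) * correlationKernel α x)
              ≤ (C : ℝ≥0∞) * ∑ t : Δ,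
                  ∫⁻ x : Fin k → EuclideanSpace ℝ (Fin n),
                    (∏ i : Fin k, ‖f i (x i)‖ₑ) * correlationKernel (β t) x := by
  refine ⟨1, one_pos, fun α p hαa hα hp hplast hscal hloc hsub => ?_⟩
  have hN : (0 : ℝ) < n := Nat.cast_pos.2 hn
  have hsumα : ∀ T : Finset (Fin k), ∑ i ∈ T, α i.castSucc (Fin.last k) = ∑ i ∈ T, a i :=
    fun T => Finset.sum_congr rfl fun i _ => hαa i
  set α₀ : Fin k → Fin k → ℝ := fun i j => α i.castSucc j.castSucc with hα₀
  set p₀ : Fin k → ℝ≥0∞ := fun i => p i.castSucc with hp₀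
  have hα₀0 : ∀ i j, i < j → 0 ≤ α₀ i j := fun i j hij =>
    hα _ _ (Fin.castSucc_lt_castSucc_iff.2 hij)
  have ha : ∀ i, 0 ≤ a i := fun i => by
    rw [← hαa]; exact hα _ _ (Fin.castSucc_lt_last i)
  have huniv : insert (Fin.last k) ((Finset.univ : Finset (Fin k)).map Fin.castSuccEmb)
      = Finset.univ := insert_last_eq_univ_iff.2 rfl
  have h5 : recipSum p₀ Finset.univ + (pairSum α₀ Finset.univ + ∑ i, a i) / n = k + 1 := by
    have := hscal
    rw [ScalingCondition, ← huniv, recipSum_insert_last hplast, pairSum_insert_last, hsumα] at this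
    exact_mod_cast this
  have hk : 0 < k := by
    rcases Nat.eq_zero_or_pos k with rfl | h
    · simp [recipSum, pairSum] at h5
    · exact h
  have hmul : ∀ {R S B : ℝ}, R + S / n < B ↔ n * R + S < n * B := by
    intro R S B
    rw [← mul_lt_mul_iff_right₀ hN, mul_add, mul_div_cancel₀ _ hN.ne']
  obtain ⟨hs, ε, hε, hδ⟩ := exists_pair_weights hk (N := n) (α := α₀) (a := a)
    (P := fun i => ((p₀ i)⁻¹).toReal) hα₀0 ha
    (fun i => ENNReal.toReal_pos (ENNReal.inv_ne_zero.2 (hp i).2.ne)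
      (ENNReal.inv_ne_top.2 (zero_lt_one.trans (hp i).1).ne')) hN
    (fun T hT => by
      have := hloc (T.map Fin.castSuccEmb) (by simpa using hT)
      rw [pairSum_map_castSucc, Finset.card_map, div_lt_iff₀ hN] at this
      linarith)
    (fun T hT => by
      have := hloc (insert (Fin.last k) (T.map Fin.castSuccEmb))
        (by rw [card_insert_last]; have := hT.card_pos; omega)
      rw [pairSum_insert_last, hsumα, card_insert_last, div_lt_iff₀ hN] at this
      push_cast at this
      linarith)
    (fun T hT => by
      have := hsub (T.map Fin.castSuccEmb) (by simpa using hT) fun h =>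
        last_notMem_map_castSucc T (h ▸ Finset.mem_univ _)
      rw [recipSum_map_castSucc, pairSum_map_castSucc, Finset.card_map, hmul] at this
      exact this)
    (fun T hT hTu => by
      have := hsub (insert (Fin.last k) (T.map Fin.castSuccEmb)) (Finset.insert_nonempty _ _)
        (fun h => hTu (insert_last_eq_univ_iff.1 h))
      rw [recipSum_insert_last hplast, pairSum_insert_last, hsumα, card_insert_last, hmul] at this
      exact_mod_cast this)
    (by
      rw [← h5, mul_add, mul_div_cancel₀ _ hN.ne']
      rfl)
  choose δ hδ0 hδs hδloc hδsub hδl using hδ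
  obtain ⟨M, hM⟩ := lintegral_prod_enorm_rpow_le hn hk ha hs hε (by ring) hδ0 hδs hδl
  -- The factor `Fin M` does not affect the exponents; summing over it produces the constant `M`.
  refine ⟨Fin M × Equiv.Perm (Fin k), inferInstance, fun t i j => α₀ i j + δ t.2 i j,
    fun t => ⟨fun i j hij => add_nonneg (hα₀0 i j hij) (hδ0 _ i j hij), ?_, fun T hT => ?_,
      fun T hT hTu => ?_⟩, fun f hf => ?_⟩
  · rw [ScalingCondition, pairSum_add, hδs]
    have : (pairSum α₀ Finset.univ + (∑ i, a i - n)) / (n : ℝ)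
        = (pairSum α₀ Finset.univ + ∑ i, a i) / n - 1 := by
      field_simp; ring
    rw [this]
    linarith
  · rw [pairSum_add, div_lt_iff₀ hN]
    linarith [hδloc t.2 T hT]
  · rw [pairSum_add, hmul]
    exact hδsub t.2 T hT hTu
  · have hfm : AEMeasurable fun x : Fin k → EuclideanSpace ℝ (Fin n) => ∏ i, ‖f i (x i)‖ₑ :=
      Finset.aemeasurable_fun_prod _ fun i _ => ((hf i).comp_quasiMeasurePreserving
        (Measure.quasiMeasurePreserving_eval _ i)).enorm
    rw [ENNReal.coe_one, one_mul, Fintype.sum_prod_type]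
    simp only [Finset.sum_const, Finset.card_univ, Fintype.card_fin, nsmul_eq_mul]
    refine (lintegral_succ_le _).trans ?_
    calc ∫⁻ x : Fin k → EuclideanSpace ℝ (Fin n), ∫⁻ y,
          (∏ i : Fin k, ‖f i ((Fin.snoc x y : Fin (k + 1) → EuclideanSpace ℝ (Fin n))
            i.castSucc)‖ₑ) * correlationKernel α (Fin.snoc x y)
        = ∫⁻ x : Fin k → EuclideanSpace ℝ (Fin n), (∏ i, ‖f i (x i)‖ₑ) * correlationKernel α₀ x *
            ∫⁻ y, ∏ i, ‖x i - y‖ₑ ^ (-(a i)) := by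
          refine lintegral_congr fun x => ?_
          rw [← lintegral_const_mul _ (by fun_prop)]
          refine lintegral_congr fun y => ?_
          rw [correlationKernel_succ]
          simp only [Fin.snoc_castSucc, Fin.snoc_last, hαa, mul_assoc, hα₀]
      _ ≤ ∫⁻ x : Fin k → EuclideanSpace ℝ (Fin n), M * ∑ r, (∏ i, ‖f i (x i)‖ₑ) *
            correlationKernel (fun i j => α₀ i j + δ r i j) x := by
          refine lintegral_mono fun x => ?_
          refine (mul_le_mul_right (hM x) _).trans (le_of_eq ?_)
          simp only [← correlationKernel_mul hα₀0 (hδ0 _), Finset.mul_sum]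
          refine Finset.sum_congr rfl fun r _ => ?_
          ring
      _ = _ := by
          have hm : ∀ r, AEMeasurable fun x : Fin k → EuclideanSpace ℝ (Fin n) =>
              (∏ i, ‖f i (x i)‖ₑ) * correlationKernel (fun i j => α₀ i j + δ r i j) x :=
            fun r => hfm.mul (measurable_correlationKernel _).aemeasurable
          rw [lintegral_const_mul'' _ (Finset.aemeasurable_fun_sum _ fun r _ => hm r),
            lintegral_finsetSum' _ fun r _ => hm r]
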